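/- Let $K$ be a field, let $m\ge 1$, and let $\Gamma$ be a tree on the vertex set $[m+1]=\{1,\dots,m+1\}$. Let $S=K[x_{ij},x_{ji} : \{i,j\}\in E(\Gamma)]$ be the polynomial ring in $2m$ indeterminates, one for each ordered pair of adjacent vertices of $\Gamma$. Order the $m$ edges of $\Gamma$ arbitrarily and write each edge $\{i,j\}$ as an ordered pair $(i,j)$ in one of the two possible ways. Let $A(\Gamma)=(a_{kl})$ be the $m\times(m+1)$ matrix over $S$ given as follows: if the $k$th edge is written as $(i,j)$, then $$a_{kl}=\begin{cases}-x_{ij}&\text{if } l=i,\\ x_{ji}&\text{if } l=j,\\ 0&\text{otherwise.}\end{cases}$$ For $j=1,\dots,m+1$ let $v_j$ be the maximal minor of $A(\Gamma)$ obtained by omitting the $j$th column, and let $I(\Gamma)=(v_1,\dots,v_{m+1})\subseteq S$, the generic monomial ideal attached to $\Gamma$. Then $I(\Gamma)$ is a Cohen–Macaulay ideal of codimension $2$; that is, the ring $S/I(\Gamma)$ is Cohen–Macaulay (it is Noetherian, and each of its localizations at a maximal ideal has depth equal to its Krull dimension), and $I(\Gamma)$ has height $2$. -/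

import Mathlib

namespace GenericTreeIdeal

/-- The depth of a local ring `R`: the supremum of the lengths of the `R`-regular sequences
contained in the maximal ideal. -/
noncomputable def depth (R : Type*) [CommRing R] [IsLocalRing R] : ℕ∞ :=
  ⨆ (rs : List R) (_ : RingTheory.Sequence.IsRegular R rs)
    (_ : ∀ r ∈ rs, r ∈ IsLocalRing.maximalIdeal R), (rs.length : ℕ∞)

/-- A Noetherian local ring is Cohen–Macaulay if its depth equals its Krull dimension. -/
def IsCohenMacaulayLocal (R : Type*) [CommRing R] [IsLocalRing R] : Prop :=
  IsNoetherianRing R ∧ ((depth R : ℕ∞) : WithBot ℕ∞) = ringKrullDim R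

/-- A Noetherian ring is Cohen–Macaulay if its localizations at all maximal ideals are
Cohen–Macaulay local rings. -/
def IsCohenMacaulayRing (R : Type*) [CommRing R] : Prop :=
  IsNoetherianRing R ∧
    ∀ (p : Ideal R) [p.IsMaximal], IsCohenMacaulayLocal (Localization.AtPrime p)

/-- An ideal `I` of `S` is a Cohen–Macaulay ideal if the ring `S ⧸ I` is Cohen–Macaulay. -/
def IsCohenMacaulayIdeal {S : Type*} [CommRing S] (I : Ideal S) : Prop :=
  IsCohenMacaulayRing (S ⧸ I)

/-- An enumeration of the edges of `Γ` by `Fin m`, where every edge is written, in one of the two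
possible ways, as an ordered pair `(i, j)` of adjacent vertices. -/
structure EdgeOrdering {m : ℕ} (Γ : SimpleGraph (Fin (m + 1))) where
  /-- The `k`th edge, written as an ordered pair of adjacent vertices. -/
  dart : Fin m → Γ.Dart
  /-- Every edge of `Γ` occurs exactly once. -/
  bijective : Function.Bijective
    fun k => (⟨(dart k).edge, (dart k).edge_mem⟩ : Γ.edgeSet)

/-- The polynomial ring over `K` with one indeterminate `x_{ij}` for each ordered pair `(i, j)` of
adjacent vertices of `Γ`, hence two indeterminates `x_{ij}` and `x_{ji}` for each edge. -/
abbrev EdgeRing (K : Type*) [Field K] {m : ℕ} (Γ : SimpleGraph (Fin (m + 1))) : Type _ :=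
  MvPolynomial Γ.Dart K

/-- The `m × (m + 1)` matrix `A(Γ)`: if the `k`th edge is `{i, j}`, written as `(i, j)`, then the
`k`th row has entry `-x_{ij}` in column `i`, entry `x_{ji}` in column `j`, and `0` elsewhere. -/
noncomputable def genericMatrix (K : Type*) [Field K] {m : ℕ} {Γ : SimpleGraph (Fin (m + 1))}
    (e : EdgeOrdering Γ) : Matrix (Fin m) (Fin (m + 1)) (EdgeRing K Γ) :=
  Matrix.of fun k l =>
    if l = (e.dart k).fst then -MvPolynomial.X (e.dart k)
    else if l = (e.dart k).snd then MvPolynomial.X (e.dart k).symm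
    else 0

/-- The maximal minor `v_j` of `A(Γ)`, obtained by omitting the `j`th column. -/
noncomputable def minor (K : Type*) [Field K] {m : ℕ} {Γ : SimpleGraph (Fin (m + 1))}
    (e : EdgeOrdering Γ) (j : Fin (m + 1)) : EdgeRing K Γ :=
  ((genericMatrix K e).submatrix id j.succAbove).det

/-- The ideal `I(Γ)` generated by the maximal minors `v_j` of `A(Γ)`. -/
noncomputable def genericIdeal (K : Type*) [Field K] {m : ℕ} {Γ : SimpleGraph (Fin (m + 1))}
    (e : EdgeOrdering Γ) : Ideal (EdgeRing K Γ) :=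
  Ideal.span (Set.range (minor K e))

end GenericTreeIdeal

/-! Induction on the tree by removing leaves. A leaf gives a column of `A(Γ)` with a single nonzero
entry `x`, whose row has one further entry `y`, in the column `p` of the leaf's neighbour. If `J` is
the ideal of minors of the smaller tree and `v` its minor at `p`, Laplace expansion gives `I(Γ) = x
J + (g)` with `g = y v ∈ J`: a basic double link. Since `x` is prime and does not divide `g`, the
pair `x, g` is a regular sequence, and there is an exact sequence `0 → S/J → S/(xJ + (g)) → S/(x, g)
→ 0` whose first map is multiplication by `x`.

Depth is measured by vanishing of `Ext^i(S/n, -)` for maximal ideals `n`, which passes along such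
sequences. Every maximal ideal of the polynomial ring `S` contains a regular sequence of length `dim
S = d + 2`, so the induction gives depth at least `d` for `S/I(Γ)` at every maximal ideal.

A prime containing `x J + (g)` contains `J` or both `x` and `g`; inductively it has height at least
two. Lifting chains of primes to `S` then bounds the dimension of `S/I(Γ)` by `d`. Finally, `I(Γ)`
lies in the ideal of the two variables of any edge, so its height is at most two. -/

open CategoryTheory Abelian RingTheory.Sequence

universe u

/-! ### Vanishing of `Ext` along short exact sequences and basic double links. -/

section ExtVanishing

variable {S : Type u} [CommRing S]

/-- The groups `Ext^i(N, M)` vanish for all `i < d`. -/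
def ExtVanishesBelow (N : ModuleCat.{u} S) (d : ℕ) (M : Type u) [AddCommGroup M] [Module S M] :
    Prop :=
  ∀ i < d, Subsingleton (Ext N (ModuleCat.of S M) i)

variable {N : ModuleCat.{u} S} {d : ℕ} {M₁ M₂ M₃ : Type u} [AddCommGroup M₁] [Module S M₁]
  [AddCommGroup M₂] [Module S M₂] [AddCommGroup M₃] [Module S M₃]
  {f : M₁ →ₗ[S] M₂} {g : M₂ →ₗ[S] M₃}

lemma shortExact_of_linearMap (hf : Function.Injective f) (hfg : Function.Exact f g)
    (hg : Function.Surjective g) :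
    (ModuleCat.shortComplexOfCompEqZero f g hfg.linearMap_comp_eq_zero).ShortExact where
  exact := ModuleCat.shortComplex_exact _ hfg
  mono_f := (ModuleCat.mono_iff_injective _).mpr hf
  epi_g := (ModuleCat.epi_iff_surjective _).mpr hg

lemma ExtVanishesBelow.middle (hf : Function.Injective f) (hfg : Function.Exact f g)
    (hg : Function.Surjective g) (h₁ : ExtVanishesBelow N d M₁) (h₃ : ExtVanishesBelow N d M₃) :
    ExtVanishesBelow N d M₂ := by
  intro i hi
  have z₁ := AddCommGrpCat.isZero_of_iff_subsingleton.mpr (h₁ i hi)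
  have z₃ := AddCommGrpCat.isZero_of_iff_subsingleton.mpr (h₃ i hi)
  exact AddCommGrpCat.subsingleton_of_isZero <| ShortComplex.Exact.isZero_of_both_zeros
    (Ext.covariant_sequence_exact₂' N (shortExact_of_linearMap hf hfg hg) i)
    (z₁.eq_zero_of_src _) (z₃.eq_zero_of_tgt _)

/-- `Ext^i(N, M₃)` sits between `Ext^i(N, M₂)` and `Ext^(i+1)(N, M₁)`; hence the shift by one on
`M₁`. -/
lemma ExtVanishesBelow.right (hf : Function.Injective f) (hfg : Function.Exact f g)
    (hg : Function.Surjective g) (h₁ : ExtVanishesBelow N (d + 1) M₁)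
    (h₂ : ExtVanishesBelow N d M₂) : ExtVanishesBelow N d M₃ := by
  intro i hi
  have z₂ := AddCommGrpCat.isZero_of_iff_subsingleton.mpr (h₂ i hi)
  have z₁ := AddCommGrpCat.isZero_of_iff_subsingleton.mpr (h₁ (i + 1) (by omega))
  exact AddCommGrpCat.subsingleton_of_isZero <| ShortComplex.Exact.isZero_of_both_zeros
    (Ext.covariant_sequence_exact₃' N (shortExact_of_linearMap hf hfg hg) i (i + 1) rfl)
    (z₂.eq_zero_of_src _) (z₁.eq_zero_of_tgt _)

lemma ExtVanishesBelow.mono {d' : ℕ} (hd : d' ≤ d) (h : ExtVanishesBelow N d M₁) :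
    ExtVanishesBelow N d' M₁ :=
  fun i hi => h i (hi.trans_le hd)

lemma ExtVanishesBelow.of_subsingleton [Subsingleton M₁] : ExtVanishesBelow N d M₁ := by
  intro i _
  have hz : Limits.IsZero (ModuleCat.of S M₁) := ModuleCat.isZero_of_subsingleton _
  refine ⟨fun a b => ?_⟩
  rw [← Ext.comp_mk₀_id a, ← Ext.comp_mk₀_id b, hz.eq_of_src (𝟙 _) 0]
  simp

section Domain

variable [IsDomain S] {x g : S}

/-- If `x` is a prime element not dividing `g`, then passing from `S` to `S ⧸ (x, g)` shortens the
range of vanishing of `Ext` by at most two. -/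
lemma ExtVanishesBelow.quotient_span_pair (hx : Prime x) (hg : ¬ x ∣ g)
    (h : ExtVanishesBelow N (d + 2) S) :
    ExtVanishesBelow N d (S ⧸ (Ideal.span {x} ⊔ Ideal.span {g})) := by
  have h₁ : ExtVanishesBelow N (d + 1) (S ⧸ Ideal.span {x}) := by
    refine ExtVanishesBelow.right (f := LinearMap.lsmul S S x) (g := (Ideal.span {x}).mkQ)
      ?_ ?_ (Submodule.mkQ_surjective _) h (h.mono (by omega))
    · intro a b hab
      exact mul_left_cancel₀ hx.ne_zero hab
    · intro a
      simp only [Submodule.mkQ_apply, Submodule.Quotient.mk_eq_zero, Ideal.mem_span_singleton',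
        Set.mem_range, LinearMap.lsmul_apply, smul_eq_mul, mul_comm x]
  have hle : Ideal.span {x} ≤ Ideal.span {x} ⊔ Ideal.span {g} := le_sup_left
  -- Multiplication by `g` is injective on the domain `S/(x)`, with cokernel `S/(x, g)`.
  refine ExtVanishesBelow.right (f := LinearMap.lsmul S (S ⧸ Ideal.span {x}) g)
    (g := Submodule.factor hle) ?_ ?_ (Submodule.factor_surjective hle) h₁ (h₁.mono (by omega))
  · refine (injective_iff_map_eq_zero _).mpr fun a => ?_
    induction a using Submodule.Quotient.induction_on with | _ a
    intro ha
    rw [LinearMap.lsmul_apply, ← Submodule.Quotient.mk_smul, Submodule.Quotient.mk_eq_zero,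
      Ideal.mem_span_singleton, smul_eq_mul] at ha
    rw [Submodule.Quotient.mk_eq_zero, Ideal.mem_span_singleton]
    exact (hx.dvd_or_dvd ha).resolve_left hg
  · intro a
    induction a using Submodule.Quotient.induction_on with | _ a
    have : Submodule.factor hle (Submodule.Quotient.mk a) = Submodule.Quotient.mk a := rfl
    rw [this, Submodule.Quotient.mk_eq_zero]
    constructor
    · intro ha
      obtain ⟨b, hb, c, hc, rfl⟩ := Submodule.mem_sup.mp ha
      obtain ⟨c, rfl⟩ := Ideal.mem_span_singleton.mp hc
      refine ⟨Submodule.Quotient.mk c, ?_⟩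
      rw [LinearMap.lsmul_apply, ← Submodule.Quotient.mk_smul, Submodule.Quotient.eq]
      simpa using hb
    · rintro ⟨b, hb⟩
      induction b using Submodule.Quotient.induction_on with | _ b
      rw [LinearMap.lsmul_apply, ← Submodule.Quotient.mk_smul, Submodule.Quotient.eq] at hb
      have h1 : g * b ∈ Ideal.span {x} ⊔ Ideal.span {g} :=
        Ideal.mul_mem_right _ _ (Ideal.mem_sup_right (Ideal.mem_span_singleton_self g))
      simpa using sub_mem h1 (hle hb)

/-- Basic double linkage preserves vanishing of `Ext` below `d`. -/
lemma ExtVanishesBelow.quotient_basicDoubleLink {J : Ideal S} (hx : Prime x) (hg : ¬ x ∣ g)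
    (hgJ : g ∈ J) (h : ExtVanishesBelow N (d + 2) S) (hJ : ExtVanishesBelow N d (S ⧸ J)) :
    ExtVanishesBelow N d (S ⧸ (Ideal.span {x} * J ⊔ Ideal.span {g})) := by
  have hmem : J ≤ Submodule.comap (LinearMap.lsmul S S x) (Ideal.span {x} * J ⊔ Ideal.span {g}) :=
    fun a ha => Ideal.mem_sup_left (Ideal.mul_mem_mul (Ideal.mem_span_singleton_self x) ha)
  have hle : Ideal.span {x} * J ⊔ Ideal.span {g} ≤ Ideal.span {x} ⊔ Ideal.span {g} :=
    sup_le_sup_right Ideal.mul_le_left _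
  refine ExtVanishesBelow.middle (f := Submodule.mapQ J _ (LinearMap.lsmul S S x) hmem)
    (g := Submodule.factor hle) ?_ ?_ (Submodule.factor_surjective hle) hJ
    (h.quotient_span_pair hx hg)
  · refine (injective_iff_map_eq_zero _).mpr fun a => ?_
    induction a using Submodule.Quotient.induction_on with | _ a
    rw [Submodule.mapQ_apply, Submodule.Quotient.mk_eq_zero, Submodule.Quotient.mk_eq_zero,
      LinearMap.lsmul_apply, smul_eq_mul]
    intro ha
    obtain ⟨b, hb, c, hc, hbc⟩ := Submodule.mem_sup.mp ha
    obtain ⟨b, hbJ, rfl⟩ := Ideal.mem_span_singleton_mul.mp hb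
    obtain ⟨c, rfl⟩ := Ideal.mem_span_singleton.mp hc
    -- From `x a = x b + g c` with `b ∈ J`, primality of `x` gives `x ∣ c`; cancelling `x` puts `a`
    -- in `J + (g) = J`.
    have hxc : x ∣ g * c := ⟨a - b, by linear_combination hbc⟩
    obtain ⟨c, rfl⟩ := (hx.dvd_or_dvd hxc).resolve_left hg
    have : a = b + g * c := mul_left_cancel₀ hx.ne_zero (by linear_combination -hbc)
    rw [this]
    exact J.add_mem hbJ (J.mul_mem_right _ hgJ)
  · intro a
    induction a using Submodule.Quotient.induction_on with | _ a
    have : Submodule.factor hle (Submodule.Quotient.mk a) = Submodule.Quotient.mk a := rfl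
    rw [this, Submodule.Quotient.mk_eq_zero]
    constructor
    · intro ha
      obtain ⟨b, hb, c, hc, rfl⟩ := Submodule.mem_sup.mp ha
      obtain ⟨b, rfl⟩ := Ideal.mem_span_singleton.mp hb
      refine ⟨Submodule.Quotient.mk b, ?_⟩
      rw [Submodule.mapQ_apply, Submodule.Quotient.eq]
      simpa using Ideal.mem_sup_right hc
    · rintro ⟨b, hb⟩
      induction b using Submodule.Quotient.induction_on with | _ b
      rw [Submodule.mapQ_apply, Submodule.Quotient.eq] at hb
      have h1 : x * b ∈ Ideal.span {x} ⊔ Ideal.span {g} :=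
        Ideal.mul_mem_right _ _ (Ideal.mem_sup_left (Ideal.mem_span_singleton_self x))
      simpa using sub_mem h1 (hle hb)

/-- A prime ideal containing a prime element and a further element not divisible by it has height
at least two. -/
lemma two_le_height_of_prime_mem {P : Ideal S} [P.IsPrime] (hx : Prime x) (hxP : x ∈ P)
    (hgP : g ∈ P) (hg : ¬ x ∣ g) : 2 ≤ P.height := by
  have hxprime : (Ideal.span {x}).IsPrime := (Ideal.span_singleton_prime hx.ne_zero).mpr hx
  have h₁ : (⊥ : Ideal S) < Ideal.span {x} :=
    bot_lt_iff_ne_bot.mpr (by simpa [Ideal.span_singleton_eq_bot] using hx.ne_zero)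
  have h₂ : Ideal.span {x} < P := by
    refine lt_of_le_of_ne ((Ideal.span_singleton_le_iff_mem P).mpr hxP) fun heq => hg ?_
    rwa [← Ideal.mem_span_singleton, heq]
  have := Ideal.height_add_one_le_of_lt_of_isPrime h₁
  have := Ideal.height_add_one_le_of_lt_of_isPrime h₂
  calc (2 : ℕ∞) = 0 + 1 + 1 := by norm_num
    _ ≤ (⊥ : Ideal S).height + 1 + 1 := by gcongr; exact bot_le
    _ ≤ (Ideal.span {x}).height + 1 := by gcongr
    _ ≤ _ := this

end Domain

end ExtVanishing

/-! ### Regular sequences in polynomial rings, and depth via `Ext`. -/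

section RegularSequences

/-- Every maximal ideal of `R` contains a weakly regular sequence of length `d`. -/
def HasRegularSequences (R : Type*) [CommRing R] (d : ℕ) : Prop :=
  ∀ n : Ideal R, n.IsMaximal →
    ∃ rs : List R, rs.length = d ∧ (∀ r ∈ rs, r ∈ n) ∧ IsWeaklyRegular R rs

lemma HasRegularSequences.of_ringEquiv {R R' : Type*} [CommRing R] [CommRing R'] {d : ℕ}
    (h : HasRegularSequences R d) (e : R ≃+* R') : HasRegularSequences R' d := by
  intro n hn
  obtain ⟨rs, hlen, hmem, hreg⟩ := h (n.comap e) (Ideal.comap_isMaximal_of_equiv e)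
  refine ⟨rs.map e, by simpa, by simpa using hmem, ?_⟩
  refine (AddEquiv.isWeaklyRegular_congr (e := e.toAddEquiv) ?_).mp hreg
  exact List.forall₂_map_right_iff.mpr (List.forall₂_same.mpr fun r _ x => by simp)

/-- By the Nullstellensatz for Jacobson rings, `R[X]/n` is integral over `R`; a monic equation for
the class of `X` is the required element. -/
lemma Polynomial.exists_monic_mem_of_isMaximal {R : Type*} [CommRing R] [IsJacobsonRing R]
    (n : Ideal (Polynomial R)) [n.IsMaximal] : ∃ f : Polynomial R, f.Monic ∧ f ∈ n := by
  obtain ⟨f, hf, hf0⟩ :=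
    Polynomial.quotient_mk_comp_C_isIntegral_of_isJacobsonRing n (Ideal.Quotient.mk n X)
  refine ⟨f, hf, ?_⟩
  rw [← Ideal.Quotient.eq_zero_iff_mem]
  have := Polynomial.hom_eval₂ f Polynomial.C (Ideal.Quotient.mk n) X
  rw [Polynomial.eval₂_C_X] at this
  rw [this]
  exact hf0

lemma Polynomial.Monic.isSMulRegular_quotient_map_C {R : Type*} [CommRing R] (J : Ideal R)
    {f : Polynomial R} (hf : f.Monic) :
    IsSMulRegular (Polynomial R ⧸ J.map Polynomial.C) f := by
  rw [isSMulRegular_iff_right_eq_zero_of_smul]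
  intro a ha
  obtain ⟨a, rfl⟩ := Ideal.Quotient.mk_surjective a
  have h : f * a ∈ J.map Polynomial.C := by
    rw [← Ideal.Quotient.eq_zero_iff_mem]
    exact ha
  rw [Ideal.Quotient.eq_zero_iff_mem]
  have hker := Polynomial.ker_mapRingHom (Ideal.Quotient.mk J)
  rw [Ideal.mk_ker] at hker
  rw [← hker, RingHom.mem_ker, Polynomial.coe_mapRingHom] at h ⊢
  rw [Polynomial.map_mul] at h
  exact (hf.map _).isRegular.left (by simpa using h)

/-- The contraction of `n` to `R` is maximal because `R` is Jacobson. Its sequence stays weakly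
regular under the flat extension `R → R[X]`, and a monic element of `n` extends it, being a
nonzerodivisor on `(R/J)[X]` for every `J`. -/
lemma HasRegularSequences.polynomial {R : Type*} [CommRing R] [IsJacobsonRing R] {d : ℕ}
    (h : HasRegularSequences R d) : HasRegularSequences (Polynomial R) (d + 1) := by
  intro n hn
  obtain ⟨rs, hlen, hmem, hreg⟩ := h (n.comap Polynomial.C)
    (Polynomial.isMaximal_comap_C_of_isJacobsonRing n)
  obtain ⟨f, hf, hfn⟩ := Polynomial.exists_monic_mem_of_isMaximal n
  refine ⟨rs.map Polynomial.C ++ [f], by simp [hlen], ?_, ?_⟩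
  · intro r hr
    rcases List.mem_append.mp hr with hr | hr
    · obtain ⟨s, hs, rfl⟩ := List.mem_map.mp hr
      exact hmem s hs
    · rw [List.mem_singleton.mp hr]
      exact hfn
  · rw [isWeaklyRegular_append_iff]
    refine ⟨hreg.of_flat (S := Polynomial R), ?_⟩
    rw [isWeaklyRegular_singleton_iff]
    have heq : (Ideal.ofList rs).map Polynomial.C =
        Ideal.ofList (rs.map Polynomial.C) • (⊤ : Ideal (Polynomial R)) := by
      rw [Ideal.map_ofList]; simp
    exact (LinearEquiv.isSMulRegular_congr (Submodule.quotEquivOfEq _ _ heq) f).mp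
      (hf.isSMulRegular_quotient_map_C _)

lemma MvPolynomial.hasRegularSequences (K : Type*) [Field K] (ι : Type*) [Finite ι] :
    HasRegularSequences (MvPolynomial ι K) (Nat.card ι) := by
  induction ι using Finite.induction_empty_option with
  | of_equiv e h =>
    rw [← Nat.card_congr e]
    exact h.of_ringEquiv (MvPolynomial.renameEquiv K e).toRingEquiv
  | h_empty => exact fun n _ => ⟨[], by simp, by simp, by simp⟩
  | h_option h =>
    rw [Finite.card_option]
    exact h.polynomial.of_ringEquiv (MvPolynomial.optionEquivLeft K _).toRingEquiv.symm

/-- One half of Rees's characterization of depth; the lemma after it is the converse half, applied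
to `S ⧸ I`. -/
lemma HasRegularSequences.extVanishesBelow {S : Type u} [CommRing S] [IsNoetherianRing S] {d : ℕ}
    (h : HasRegularSequences S d) (n : Ideal S) [hn : n.IsMaximal] :
    ExtVanishesBelow (ModuleCat.of S (S ⧸ n)) d S := by
  obtain ⟨rs, hlen, hmem, hreg⟩ := h n hn
  have hlt : n • (⊤ : Submodule S S) < ⊤ := by
    simpa [lt_top_iff_ne_top] using hn.ne_top
  have hreg' : IsRegular S rs := by
    refine ⟨hreg, fun heq => hlt.ne (top_le_iff.mp ?_)⟩
    exact heq.le.trans (Submodule.smul_mono_left (Ideal.span_le.mpr hmem))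
  intro i hi
  refine ModuleCat.subsingleton_ext_of_exists_isRegular n _ ?_ (ModuleCat.of S S) hlt rs hmem
    hreg' i (by omega)
  rw [Module.support_eq_zeroLocus, Ideal.annihilator_quotient]

lemma exists_isWeaklyRegular_quotient_of_extVanishesBelow {S : Type u} [CommRing S]
    [IsNoetherianRing S] {d : ℕ} {I n : Ideal S} [hn : n.IsMaximal] (hI : I ≤ n)
    (h : ExtVanishesBelow (ModuleCat.of S (S ⧸ n)) d (S ⧸ I)) :
    ∃ rs : List S, rs.length = d ∧ (∀ r ∈ rs, r ∈ n) ∧ IsWeaklyRegular (S ⧸ I) rs := by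
  suffices hlt : n • (⊤ : Submodule S (S ⧸ I)) < ⊤ by
    obtain ⟨rs, h₁, h₂, h₃⟩ := ModuleCat.exists_isRegular_of_exists_subsingleton_ext n d
      (ModuleCat.of S (S ⧸ I)) hlt (ModuleCat.of S (S ⧸ n))
      (by rw [Module.support_eq_zeroLocus, Ideal.annihilator_quotient]) h
    exact ⟨rs, h₁, h₂, h₃.toIsWeaklyRegular⟩
  rw [lt_top_iff_ne_top]
  intro htop
  have h1 : (Submodule.Quotient.mk 1 : S ⧸ I) ∈ n • (⊤ : Submodule S (S ⧸ I)) := by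
    rw [htop]; trivial
  have h2 : n • (⊤ : Submodule S (S ⧸ I)) ≤ Submodule.map I.mkQ n := by
    rw [Submodule.smul_le]
    intro r hr a _
    induction a using Submodule.Quotient.induction_on with | _ a
    exact ⟨r * a, n.mul_mem_right _ hr, rfl⟩
  obtain ⟨a, ha, hab⟩ := h2 h1
  have : a - 1 ∈ n := hI ((Submodule.Quotient.eq I).mp hab)
  exact hn.ne_top ((Ideal.eq_top_iff_one n).mpr (by simpa using sub_mem ha this))

end RegularSequences

/-! ### Maximal minors of tree-like matrices. -/

section Minors

variable {S : Type*} [CommRing S]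

/-- The maximal minor of an `m × (m + 1)` matrix obtained by omitting the column `j`. -/
def Matrix.maximalMinor {m : ℕ} (A : Matrix (Fin m) (Fin (m + 1)) S) (j : Fin (m + 1)) : S :=
  (A.submatrix id j.succAbove).det

/-- The ideal generated by the maximal minors of an `m × (m + 1)` matrix. -/
def Matrix.maximalMinorIdeal {m : ℕ} (A : Matrix (Fin m) (Fin (m + 1)) S) : Ideal S :=
  Ideal.span (Set.range A.maximalMinor)

lemma exists_perm_comp_succAbove {m : ℕ} (τ : Equiv.Perm (Fin (m + 1))) (j : Fin (m + 1)) :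
    ∃ ρ : Equiv.Perm (Fin m), ∀ i, τ (j.succAbove i) = (τ j).succAbove (ρ i) := by
  have h : ∀ i, ∃ k, (τ j).succAbove k = τ (j.succAbove i) := fun i =>
    Fin.exists_succAbove_eq fun h => Fin.succAbove_ne j i (τ.injective h)
  choose ρ hρ using h
  have hinj : Function.Injective ρ := fun a b hab => by
    have := (hρ a).symm.trans ((congrArg _ hab).trans (hρ b))
    exact Fin.succAbove_right_injective (τ.injective this)
  exact ⟨Equiv.ofBijective ρ (Finite.injective_iff_bijective.mp hinj), fun i => (hρ i).symm⟩

lemma Matrix.associated_maximalMinor_submatrix {m : ℕ} (A : Matrix (Fin m) (Fin (m + 1)) S)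
    (σ : Equiv.Perm (Fin m)) (τ : Equiv.Perm (Fin (m + 1))) (j : Fin (m + 1)) :
    Associated ((A.submatrix σ τ).maximalMinor j) (A.maximalMinor (τ j)) := by
  obtain ⟨ρ, hρ⟩ := exists_perm_comp_succAbove τ j
  have heq : (A.submatrix σ τ).submatrix id j.succAbove =
      ((A.submatrix id (τ j).succAbove).submatrix id ρ).submatrix σ id := by
    ext a b
    simp [hρ]
  have hunit (π : Equiv.Perm (Fin m)) : IsUnit ((Equiv.Perm.sign π : ℤ) : S) :=
    (Units.isUnit _).map (Int.castRingHom S)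
  rw [Matrix.maximalMinor, heq, Matrix.det_permute, Matrix.det_permute']
  exact (associated_unit_mul_left _ _ (hunit σ)).trans (associated_unit_mul_left _ _ (hunit ρ))

lemma Matrix.maximalMinorIdeal_submatrix {m : ℕ} (A : Matrix (Fin m) (Fin (m + 1)) S)
    (σ : Equiv.Perm (Fin m)) (τ : Equiv.Perm (Fin (m + 1))) :
    (A.submatrix σ τ).maximalMinorIdeal = A.maximalMinorIdeal := by
  refine le_antisymm (Ideal.span_le.mpr ?_) (Ideal.span_le.mpr ?_)
  · rintro _ ⟨j, rfl⟩
    exact Ideal.mem_of_dvd _ (A.associated_maximalMinor_submatrix σ τ j).symm.dvd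
      (Ideal.subset_span ⟨τ j, rfl⟩)
  · rintro _ ⟨j, rfl⟩
    have := A.associated_maximalMinor_submatrix σ τ (τ.symm j)
    rw [τ.apply_symm_apply] at this
    exact Ideal.mem_of_dvd _ this.dvd (Ideal.subset_span ⟨_, rfl⟩)

lemma Matrix.maximalMinor_succ {m : ℕ} (A : Matrix (Fin (m + 1)) (Fin (m + 2)) S)
    (hcol : ∀ k : Fin m, A k.succ 0 = 0) (j : Fin (m + 1)) :
    A.maximalMinor j.succ = A 0 0 * (A.submatrix Fin.succ Fin.succ).maximalMinor j := by
  rw [Matrix.maximalMinor, Matrix.det_succ_column_zero, Finset.sum_eq_single 0]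
  · simp only [Fin.val_zero, pow_zero, one_mul, Matrix.submatrix_apply, id, Fin.succ_succAbove_zero,
      Matrix.maximalMinor]
    congr 2
    ext a b
    simp
  · intro b _ hb
    obtain ⟨k, rfl⟩ := Fin.exists_succ_eq.mpr hb
    simp [hcol]
  · simp

lemma Matrix.associated_maximalMinor_zero {m : ℕ} (A : Matrix (Fin (m + 1)) (Fin (m + 2)) S)
    (p : Fin (m + 1)) (hrow : ∀ l : Fin (m + 1), l ≠ p → A 0 l.succ = 0) :
    Associated (A.maximalMinor 0)
      (A 0 p.succ * (A.submatrix Fin.succ Fin.succ).maximalMinor p) := by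
  have h : A.maximalMinor 0 =
      (-1) ^ (p : ℕ) * (A 0 p.succ * (A.submatrix Fin.succ Fin.succ).maximalMinor p) := by
    rw [Matrix.maximalMinor, Matrix.det_succ_row_zero, Finset.sum_eq_single p]
    · simp only [Matrix.submatrix_apply, id, Fin.succAbove_zero, Matrix.maximalMinor, mul_assoc]
      rfl
    · intro b _ hb
      simp [hrow b hb]
    · simp
  rw [h]
  exact associated_unit_mul_left _ _ (isUnit_one.neg.pow _)

/-- The nonzero entries of a matrix with these properties form the incidence relation of a tree,
with the rows as edges and the columns as vertices. -/
structure Matrix.IsTreeLike {m : ℕ} (A : Matrix (Fin m) (Fin (m + 1)) S) : Prop where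
  /-- Every row has at most two nonzero entries. -/
  card_row_le : ∀ k, {l | A k l ≠ 0}.ncard ≤ 2
  /-- Any two columns are linked by a chain of rows. -/
  connected : ∀ C : Set (Fin (m + 1)), C.Nonempty →
    (∀ k l l', A k l ≠ 0 → A k l' ≠ 0 → l ∈ C → l' ∈ C) → C = Set.univ

namespace Matrix.IsTreeLike

lemma submatrix {m : ℕ} {A : Matrix (Fin m) (Fin (m + 1)) S} (hA : A.IsTreeLike)
    (σ : Equiv.Perm (Fin m)) (τ : Equiv.Perm (Fin (m + 1))) : (A.submatrix σ τ).IsTreeLike where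
  card_row_le k := by
    have : {l | A.submatrix σ τ k l ≠ 0} = τ ⁻¹' {l | A (σ k) l ≠ 0} := rfl
    rw [this, Set.ncard_preimage_of_injective_subset_range τ.injective (by simp)]
    exact hA.card_row_le _
  connected C hC h := by
    have := hA.connected (τ '' C) (hC.image _) ?_
    · refine Set.eq_univ_of_forall fun l => ?_
      have hl : τ l ∈ τ '' C := this ▸ Set.mem_univ _
      rwa [τ.injective.mem_set_image] at hl
    · rintro k _ l' hl hl' ⟨l, hl₀, rfl⟩
      refine ⟨τ.symm l', h (σ.symm k) l (τ.symm l') (by simpa) (by simpa) hl₀, by simp⟩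

/-- Double counting: if every column had two nonzero entries, there would be at least `2(m + 2)` of
them, but the rows allow only `2(m + 1)`. Connectedness supplies the second entry of the leaf's row.
-/
lemma exists_leaf {m : ℕ} {A : Matrix (Fin (m + 1)) (Fin (m + 2)) S} (hA : A.IsTreeLike) :
    ∃ k₀ l₀ p, p ≠ l₀ ∧ A k₀ l₀ ≠ 0 ∧ A k₀ p ≠ 0 ∧ (∀ k ≠ k₀, A k l₀ = 0) ∧
      ∀ l, l ≠ l₀ → l ≠ p → A k₀ l = 0 := by
  classical
  have hclosed (l : Fin (m + 2)) : ∃ k p, p ≠ l ∧ A k l ≠ 0 ∧ A k p ≠ 0 := by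
    by_contra! hcon
    have := hA.connected {l} (Set.singleton_nonempty l) fun k a b ha hb hal => by
      rw [Set.mem_singleton_iff] at hal ⊢
      subst hal
      by_contra hne
      exact hb (hcon k b hne ha)
    obtain ⟨l', hl'⟩ := exists_ne l
    exact hl' (this.symm ▸ Set.mem_univ l' : l' ∈ ({l} : Set _))
  have hcount : ∃ l, (Finset.univ.filter fun k => A k l ≠ 0).card ≤ 1 := by
    by_contra! hcon
    have h₁ := Finset.sum_card_bipartiteAbove_eq_sum_card_bipartiteBelow
      (s := (Finset.univ : Finset (Fin (m + 1)))) (t := (Finset.univ : Finset (Fin (m + 2))))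
      (fun k l => A k l ≠ 0)
    have h₂ : ∑ k, ((Finset.univ : Finset (Fin (m + 2))).bipartiteAbove
        (fun k l => A k l ≠ 0) k).card ≤ ∑ _k : Fin (m + 1), 2 := by
      refine Finset.sum_le_sum fun k _ => ?_
      have := hA.card_row_le k
      rwa [Set.ncard_eq_toFinset_card', Set.toFinset_ofPred] at this
    have h₃ : ∑ _l : Fin (m + 2), 2 ≤ ∑ l, ((Finset.univ : Finset (Fin (m + 1))).bipartiteBelow
        (fun k l => A k l ≠ 0) l).card :=
      Finset.sum_le_sum fun l _ => hcon l
    simp only [Finset.sum_const, Finset.card_univ, Fintype.card_fin, smul_eq_mul] at h₂ h₃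
    omega
  obtain ⟨l₀, hl₀⟩ := hcount
  obtain ⟨k₀, p, hp, hk₀, hkp⟩ := hclosed l₀
  refine ⟨k₀, l₀, p, hp, hk₀, hkp, fun k hk => ?_, fun l hl hlp => ?_⟩
  · by_contra hne
    exact hk (Finset.card_le_one.mp hl₀ k (by simpa) k₀ (by simpa))
  · by_contra hne
    have h3 : ({l₀, p, l} : Finset (Fin (m + 2))).card = 3 :=
      Finset.card_eq_three.mpr ⟨l₀, p, l, hp.symm, hl.symm, hlp.symm, rfl⟩
    have hsub : (({l₀, p, l} : Finset (Fin (m + 2))) : Set (Fin (m + 2))) ⊆ {l | A k₀ l ≠ 0} := by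
      intro a ha
      simp only [Finset.coe_insert, Finset.coe_singleton, Set.mem_insert_iff,
        Set.mem_singleton_iff] at ha
      rcases ha with rfl | rfl | rfl <;> assumption
    have h4 := (Set.ncard_le_ncard hsub (Set.toFinite _)).trans (hA.card_row_le k₀)
    rw [Set.ncard_coe_finset, h3] at h4
    omega

/-- Up to permutations of rows and columns, the first column of a tree-like matrix belongs to a
leaf and the first row to its edge; deleting both leaves a tree-like matrix. -/
lemma exists_normalForm {m : ℕ} {A : Matrix (Fin (m + 1)) (Fin (m + 2)) S} (hA : A.IsTreeLike) :
    ∃ (σ : Equiv.Perm (Fin (m + 1))) (τ : Equiv.Perm (Fin (m + 2))) (p : Fin (m + 1)),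
      A (σ 0) (τ 0) ≠ 0 ∧ A (σ 0) (τ p.succ) ≠ 0 ∧ (∀ k : Fin m, A (σ k.succ) (τ 0) = 0) ∧
      (∀ l : Fin (m + 1), l ≠ p → A (σ 0) (τ l.succ) = 0) ∧
      ((A.submatrix σ τ).submatrix Fin.succ Fin.succ).IsTreeLike := by
  classical
  obtain ⟨k₀, l₀, p', hp', hk₀, hkp, hcol, hrow⟩ := hA.exists_leaf
  set σ : Equiv.Perm (Fin (m + 1)) := Equiv.swap 0 k₀ with hσ
  set τ : Equiv.Perm (Fin (m + 2)) := Equiv.swap 0 l₀ with hτ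
  have hσ0 : σ 0 = k₀ := Equiv.swap_apply_left _ _
  have hτ0 : τ 0 = l₀ := Equiv.swap_apply_left _ _
  obtain ⟨p, hp⟩ : ∃ p : Fin (m + 1), p.succ = τ.symm p' :=
    Fin.exists_succ_eq.mpr fun h => hp' (by rw [← hτ0, ← h, τ.apply_symm_apply])
  have hτp : τ p.succ = p' := by rw [hp, τ.apply_symm_apply]
  have hcol' (k : Fin m) : A (σ k.succ) (τ 0) = 0 := by
    rw [hτ0]
    exact hcol _ fun h => Fin.succ_ne_zero k (σ.injective (h.trans hσ0.symm))
  have hrow' (l : Fin (m + 1)) (hl : l ≠ p) : A (σ 0) (τ l.succ) = 0 := by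
    rw [hσ0]
    refine hrow _ (fun h => Fin.succ_ne_zero l (τ.injective (h.trans hτ0.symm))) fun h => ?_
    exact hl (Fin.succ_injective _ (τ.injective (h.trans hτp.symm)))
  refine ⟨σ, τ, p, by rwa [hσ0, hτ0], by rwa [hσ0, hτp], hcol', hrow', ?_, ?_⟩
  · intro k
    refine le_trans ?_ ((hA.submatrix σ τ).card_row_le k.succ)
    rw [← Set.ncard_image_of_injective _ (Fin.succ_injective _)]
    refine Set.ncard_le_ncard ?_ (Set.toFinite _)
    rintro _ ⟨l, hl, rfl⟩
    exact hl
  · intro C hC h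
    -- A closed set of columns of the smaller matrix extends to the larger one by adding the leaf
    -- exactly when its neighbour `p` belongs to the set.
    have key := (hA.submatrix σ τ).connected
      (Fin.succ '' C ∪ {l | l = 0 ∧ p ∈ C}) ((hC.image _).inl) ?_
    · refine Set.eq_univ_of_forall fun l => ?_
      have hl : l.succ ∈ Fin.succ '' C ∪ {l | l = 0 ∧ p ∈ C} := key ▸ Set.mem_univ _
      rcases hl with ⟨l', hl', h⟩ | ⟨h, _⟩
      · rwa [← Fin.succ_injective _ h]
      · exact absurd h (Fin.succ_ne_zero l)
    · have hmem (l : Fin (m + 1)) :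
          l.succ ∈ Fin.succ '' C ∪ {l | l = 0 ∧ p ∈ C} ↔ l ∈ C := by
        simp [Fin.succ_ne_zero]
      have hmem0 : (0 : Fin (m + 2)) ∈ Fin.succ '' C ∪ {l | l = 0 ∧ p ∈ C} ↔ p ∈ C := by
        simp [Fin.succ_ne_zero]
      intro k l l' hl hl'
      simp only [Matrix.submatrix_apply] at hl hl'
      induction k using Fin.cases with
      | zero =>
        have aux (a : Fin (m + 2)) (ha : A (σ 0) (τ a) ≠ 0) :
            a ∈ Fin.succ '' C ∪ {l | l = 0 ∧ p ∈ C} ↔ p ∈ C := by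
          induction a using Fin.cases with
          | zero => exact hmem0
          | succ a =>
            rw [hmem]
            by_cases hap : a = p
            · rw [hap]
            · exact absurd (hrow' a hap) ha
        rw [aux l hl, aux l' hl']
        exact id
      | succ k =>
        induction l using Fin.cases with
        | zero => exact absurd (hcol' k) hl
        | succ l =>
          induction l' using Fin.cases with
          | zero => exact absurd (hcol' k) hl'
          | succ l' =>
            rw [hmem, hmem]
            exact h k l l' hl hl'

/-- Up to sign, each minor is a product of nonzero entries, as removing leaves shows. -/
lemma maximalMinor_ne_zero [IsDomain S] {m : ℕ} {A : Matrix (Fin m) (Fin (m + 1)) S}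
    (hA : A.IsTreeLike) (j : Fin (m + 1)) : A.maximalMinor j ≠ 0 := by
  induction m with
  | zero => simp [Matrix.maximalMinor]
  | succ m ih =>
    obtain ⟨σ, τ, p, h₀, hp, hcol, hrow, hA'⟩ := hA.exists_normalForm
    have hassoc := A.associated_maximalMinor_submatrix σ τ (τ.symm j)
    rw [τ.apply_symm_apply] at hassoc
    rw [← hassoc.ne_zero_iff]
    induction τ.symm j using Fin.cases with
    | zero =>
      rw [(Matrix.associated_maximalMinor_zero _ p (by simpa using hrow)).ne_zero_iff]
      exact mul_ne_zero hp (ih hA' p)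
    | succ l =>
      rw [Matrix.maximalMinor_succ _ (by simpa using hcol)]
      exact mul_ne_zero h₀ (ih hA' l)

end Matrix.IsTreeLike

end Minors

/-! ### The leaf induction as a basic double link. -/

section BasicDoubleLinks

variable {S : Type u} [CommRing S]

/-- The nonzero entries of the matrix are prime, and none divides another one. -/
structure Matrix.HasDistinctPrimeEntries {m n : ℕ} (A : Matrix (Fin m) (Fin n) S) : Prop where
  prime : ∀ k l, A k l ≠ 0 → Prime (A k l)
  eq_of_dvd : ∀ k l k' l', A k l ≠ 0 → A k' l' ≠ 0 → A k l ∣ A k' l' → k = k' ∧ l = l'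

lemma Matrix.HasDistinctPrimeEntries.submatrix {m n m' n' : ℕ} {A : Matrix (Fin m) (Fin n) S}
    (hA : A.HasDistinctPrimeEntries) {σ : Fin m' → Fin m} {τ : Fin n' → Fin n}
    (hσ : Function.Injective σ) (hτ : Function.Injective τ) :
    (A.submatrix σ τ).HasDistinctPrimeEntries where
  prime _ _ h := hA.prime _ _ h
  eq_of_dvd _ _ _ _ h h' hdvd :=
    (hA.eq_of_dvd _ _ _ _ h h' hdvd).imp (fun h => hσ h) fun h => hτ h

lemma Matrix.IsTreeLike.map {T : Type*} [CommRing T] {m : ℕ}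
    {A : Matrix (Fin m) (Fin (m + 1)) S} (hA : A.IsTreeLike) (f : S →+* T)
    (hf : ∀ k l, A k l ≠ 0 → f (A k l) ≠ 0) : (A.map f).IsTreeLike := by
  have hiff (k l) : A.map f k l ≠ 0 ↔ A k l ≠ 0 :=
    ⟨fun h h0 => h (by simp [h0]), fun h => hf k l h⟩
  refine ⟨fun k => ?_, fun C hC h => hA.connected C hC fun k l l' hl hl' =>
    h k l l' ((hiff k l).mpr hl) ((hiff k l').mpr hl')⟩
  simp only [hiff]
  exact hA.card_row_le k

lemma Matrix.map_maximalMinor {T : Type*} [CommRing T] {m : ℕ} (f : S →+* T)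
    (A : Matrix (Fin m) (Fin (m + 1)) S) (j : Fin (m + 1)) :
    f (A.maximalMinor j) = (A.map f).maximalMinor j := by
  rw [Matrix.maximalMinor, RingHom.map_det]
  rfl

/-- The ideal of maximal minors of a tree-like matrix arises by a basic double link from that of
the matrix with a leaf deleted. -/
lemma Matrix.IsTreeLike.exists_basicDoubleLink [IsDomain S] {m : ℕ}
    {A : Matrix (Fin (m + 1)) (Fin (m + 2)) S} (hA : A.IsTreeLike)
    (hA' : A.HasDistinctPrimeEntries) :
    ∃ (B : Matrix (Fin m) (Fin (m + 1)) S) (x g : S), B.IsTreeLike ∧ B.HasDistinctPrimeEntries ∧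
      Prime x ∧ ¬ x ∣ g ∧ g ∈ B.maximalMinorIdeal ∧
      A.maximalMinorIdeal = Ideal.span {x} * B.maximalMinorIdeal ⊔ Ideal.span {g} := by
  obtain ⟨σ, τ, p, h₀, hp, hcol, hrow, hB⟩ := hA.exists_normalForm
  set B := (A.submatrix σ τ).submatrix Fin.succ Fin.succ with hBdef
  set x := A (σ 0) (τ 0)
  have hB' : B.HasDistinctPrimeEntries :=
    (hA'.submatrix σ.injective τ.injective).submatrix (Fin.succ_injective _) (Fin.succ_injective _)
  have hx : Prime x := hA'.prime _ _ h₀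
  have hxprime : (Ideal.span {x}).IsPrime := (Ideal.span_singleton_prime hx.ne_zero).mpr hx
  -- Modulo the prime `x` no entry of `B` vanishes, so `B` stays tree-like over the domain `S/(x)`
  -- and its minors stay nonzero.
  have hminor : ¬ x ∣ B.maximalMinor p := by
    rw [← Ideal.mem_span_singleton, ← Ideal.Quotient.eq_zero_iff_mem, Matrix.map_maximalMinor]
    refine (hB.map _ fun k l hkl h => ?_).maximalMinor_ne_zero p
    rw [Ideal.Quotient.eq_zero_iff_mem, Ideal.mem_span_singleton] at h
    exact Fin.succ_ne_zero k (σ.injective (hA'.eq_of_dvd _ _ _ _ h₀ hkl h).1).symm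
  refine ⟨B, x, A (σ 0) (τ p.succ) * B.maximalMinor p, hB, hB', hx, fun h => ?_,
    Ideal.mul_mem_left _ _ (Ideal.subset_span ⟨p, rfl⟩), ?_⟩
  · rcases hx.dvd_or_dvd h with h | h
    · exact Fin.succ_ne_zero p (τ.injective (hA'.eq_of_dvd _ _ _ _ h₀ hp h).2).symm
    · exact hminor h
  · have hzero := Matrix.associated_maximalMinor_zero (A.submatrix σ τ) p hrow
    have hsucc := Matrix.maximalMinor_succ (A.submatrix σ τ) hcol
    rw [← A.maximalMinorIdeal_submatrix σ τ]
    refine le_antisymm (Ideal.span_le.mpr ?_) (sup_le ?_ ?_)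
    · rintro _ ⟨j, rfl⟩
      induction j using Fin.cases with
      | zero => exact Ideal.mem_sup_right (Ideal.mem_span_singleton.mpr hzero.symm.dvd)
      | succ j =>
        rw [hsucc]
        exact Ideal.mem_sup_left (Ideal.mul_mem_mul (Ideal.mem_span_singleton_self x)
          (Ideal.subset_span ⟨j, rfl⟩))
    · rw [Matrix.maximalMinorIdeal, Ideal.span_mul_span', Set.singleton_mul, Ideal.span_le]
      rintro _ ⟨_, ⟨j, rfl⟩, rfl⟩
      exact Ideal.subset_span ⟨j.succ, hsucc j⟩
    · rw [Ideal.span_singleton_le_iff_mem]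
      exact Ideal.mem_of_dvd _ hzero.dvd (Ideal.subset_span ⟨0, rfl⟩)

lemma Matrix.maximalMinorIdeal_eq_top (A : Matrix (Fin 0) (Fin 1) S) :
    A.maximalMinorIdeal = ⊤ :=
  (Ideal.eq_top_iff_one _).mpr (Ideal.subset_span ⟨0, by simp [Matrix.maximalMinor]⟩)

lemma Matrix.IsTreeLike.extVanishesBelow [IsDomain S] {N : ModuleCat.{u} S} {d m : ℕ}
    (h : ExtVanishesBelow N (d + 2) S) {A : Matrix (Fin m) (Fin (m + 1)) S}
    (hA : A.IsTreeLike) (hA' : A.HasDistinctPrimeEntries) :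
    ExtVanishesBelow N d (S ⧸ A.maximalMinorIdeal) := by
  induction m with
  | zero =>
    have : Subsingleton (S ⧸ A.maximalMinorIdeal) :=
      Ideal.Quotient.subsingleton_iff.mpr A.maximalMinorIdeal_eq_top
    exact .of_subsingleton
  | succ m ih =>
    obtain ⟨B, x, g, hB, hB', hx, hxg, hg, heq⟩ := hA.exists_basicDoubleLink hA'
    rw [heq]
    exact h.quotient_basicDoubleLink hx hxg hg (ih hB hB')

lemma Matrix.IsTreeLike.two_le_height [IsDomain S] {m : ℕ} {A : Matrix (Fin m) (Fin (m + 1)) S}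
    (hA : A.IsTreeLike) (hA' : A.HasDistinctPrimeEntries) {P : Ideal S} [hP : P.IsPrime]
    (h : A.maximalMinorIdeal ≤ P) : 2 ≤ P.height := by
  induction m with
  | zero => exact absurd (top_le_iff.mp (A.maximalMinorIdeal_eq_top ▸ h)) hP.ne_top
  | succ m ih =>
    obtain ⟨B, x, g, hB, hB', hx, hxg, hg, heq⟩ := hA.exists_basicDoubleLink hA'
    rw [heq, sup_le_iff, hP.mul_le, Ideal.span_singleton_le_iff_mem,
      Ideal.span_singleton_le_iff_mem] at h
    rcases h.1 with h₁ | h₁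
    · exact two_le_height_of_prime_mem hx h₁ h.2 hxg
    · exact ih hB hB' h₁

end BasicDoubleLinks

/-! ### From vanishing of `Ext` to the Cohen–Macaulay property. -/

namespace GenericTreeIdeal

open RingTheory.Sequence

/-- A chain of primes below `p` lifts to `S`, and its lowest member, which contains `I`, already has
height at least `h`. -/
lemma natCast_add_le_height_comap {S : Type*} [CommRing S] {I : Ideal S} {h : ℕ∞}
    (hI : ∀ P : Ideal S, P.IsPrime → I ≤ P → h ≤ P.height) (n : ℕ) (p : Ideal (S ⧸ I))
    [p.IsPrime] (hp : n ≤ p.height) : n + h ≤ (p.comap (Ideal.Quotient.mk I)).height := by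
  have hle (q : Ideal (S ⧸ I)) : I ≤ q.comap (Ideal.Quotient.mk I) := by
    intro a ha
    rw [Ideal.mem_comap, Ideal.Quotient.eq_zero_iff_mem.mpr ha]
    exact q.zero_mem
  induction n generalizing p with
  | zero => simpa using hI _ inferInstance (hle p)
  | succ n ih =>
    have hnot : ¬ p.height ≤ n := fun hle =>
      absurd (hp.trans hle) (by exact_mod_cast Nat.not_succ_le_self n)
    rw [Ideal.height_le_iff] at hnot
    push Not at hnot
    obtain ⟨q, hq, hqp, hnq⟩ := hnot
    have hlt : q.comap (Ideal.Quotient.mk I) < p.comap (Ideal.Quotient.mk I) :=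
      (Ideal.comap_mono hqp.le).lt_of_not_ge fun hle =>
        hqp.not_ge ((Ideal.comap_le_comap_iff_of_surjective _
          Ideal.Quotient.mk_surjective _ _).mp hle)
    calc ((n + 1 : ℕ) : ℕ∞) + h = (n + h) + 1 := by push_cast; ring
      _ ≤ (q.comap (Ideal.Quotient.mk I)).height + 1 := by gcongr; exact ih q hnq
      _ ≤ _ := Ideal.height_add_one_le_of_lt_of_isPrime hlt

lemma depth_le_ringKrullDim (R : Type*) [CommRing R] [IsLocalRing R] [IsNoetherianRing R] :
    ((depth R : ℕ∞) : WithBot ℕ∞) ≤ ringKrullDim R := by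
  rw [← IsLocalRing.maximalIdeal_height_eq_ringKrullDim, WithBot.coe_le_coe]
  refine iSup_le fun rs => iSup_le fun hrs => iSup_le fun _ => ?_
  have hdim := ringKrullDim_add_length_eq_ringKrullDim_of_isRegular rs hrs
  have hnt : Nontrivial (R ⧸ Ideal.ofList rs) := by
    rw [Ideal.Quotient.nontrivial_iff]
    intro htop
    exact hrs.top_ne_smul (by simp [htop])
  rw [← WithBot.coe_le_coe, IsLocalRing.maximalIdeal_height_eq_ringKrullDim, ← hdim]
  exact le_add_of_nonneg_left ringKrullDim_nonneg_of_nontrivial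

/-- If `S` has dimension at most `d + 2`, all primes containing `I` have height at least two, and
`Ext^i(S ⧸ n, S ⧸ I)` vanishes for all maximal ideals `n` and all `i < d`, then `I` is a
Cohen–Macaulay ideal. -/
lemma isCohenMacaulayIdeal_of_extVanishesBelow {S : Type*} [CommRing S] [IsNoetherianRing S]
    {d : ℕ} {I : Ideal S} (hdim : ringKrullDim S ≤ (d + 2 : ℕ))
    (hI : ∀ P : Ideal S, P.IsPrime → I ≤ P → 2 ≤ P.height)
    (hext : ∀ n : Ideal S, n.IsMaximal →
      ExtVanishesBelow (ModuleCat.of S (S ⧸ n)) d (S ⧸ I)) :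
    IsCohenMacaulayIdeal I := by
  refine ⟨inferInstance, fun p hp => ⟨inferInstance, le_antisymm (depth_le_ringKrullDim _) ?_⟩⟩
  have hn : (p.comap (Ideal.Quotient.mk I)).IsMaximal :=
    Ideal.comap_isMaximal_of_surjective _ Ideal.Quotient.mk_surjective
  have hle : I ≤ p.comap (Ideal.Quotient.mk I) := by
    intro a ha
    rw [Ideal.mem_comap, Ideal.Quotient.eq_zero_iff_mem.mpr ha]
    exact p.zero_mem
  -- Otherwise the preimage of `p` in `S` would have height at least `(d + 1) + 2`, exceeding `dim
  -- S`.
  have hheight : p.height ≤ d := by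
    by_contra! hlt
    have h₁ := natCast_add_le_height_comap hI (d + 1) p
      (by push_cast; exact Order.add_one_le_of_lt hlt)
    have h₂ : ((p.comap (Ideal.Quotient.mk I)).height : WithBot ℕ∞) ≤ ((d + 2 : ℕ) : ℕ∞) :=
      Ideal.height_le_ringKrullDim_of_isPrime.trans (by exact_mod_cast hdim)
    have h₃ := h₁.trans (WithBot.coe_le_coe.mp h₂)
    have h₄ : d + 1 + 2 ≤ d + 2 := by exact_mod_cast h₃
    omega
  obtain ⟨rs, hlen, hmem, hreg⟩ := exists_isWeaklyRegular_quotient_of_extVanishesBelow hle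
    (hext _ hn)
  have hreg₁ : IsWeaklyRegular (S ⧸ I) (rs.map (algebraMap S (S ⧸ I))) :=
    (isWeaklyRegular_map_algebraMap_iff (S ⧸ I) (S ⧸ I) rs).mpr hreg
  have hmem₁ : ∀ r ∈ rs.map (algebraMap S (S ⧸ I)), r ∈ p := by
    simpa using hmem
  have hreg₂ := hreg₁.isRegular_of_isLocalization_of_mem (Localization.AtPrime p) p hmem₁
  rw [IsLocalization.AtPrime.ringKrullDim_eq_height p (Localization.AtPrime p),
    WithBot.coe_le_coe]
  refine hheight.trans ?_
  refine le_iSup_of_le _ (le_iSup_of_le hreg₂ (le_iSup_of_le ?_ (by simp [hlen])))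
  intro r hr
  obtain ⟨s, hs, rfl⟩ := List.mem_map.mp hr
  exact (IsLocalization.AtPrime.to_map_mem_maximal_iff _ p s).mpr (hmem₁ s hs)

/-! ### The generic matrix of a tree. -/

variable {K : Type*} [Field K] {m : ℕ} {Γ : SimpleGraph (Fin (m + 1))} (e : EdgeOrdering Γ)

lemma genericMatrix_apply_fst (k : Fin m) :
    genericMatrix K e k (e.dart k).fst = -MvPolynomial.X (e.dart k) := by
  simp [genericMatrix]

lemma genericMatrix_apply_snd (k : Fin m) :
    genericMatrix K e k (e.dart k).snd = MvPolynomial.X (e.dart k).symm := by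
  simp [genericMatrix, (e.dart k).snd_ne_fst]

lemma genericMatrix_apply_of_ne (k : Fin m) {l : Fin (m + 1)} (h₁ : l ≠ (e.dart k).fst)
    (h₂ : l ≠ (e.dart k).snd) : genericMatrix K e k l = 0 := by
  simp [genericMatrix, h₁, h₂]

/-- The edge and first vertex of `d` recover the row and column, so distinct positions carry
distinct variables. -/
lemma exists_associated_X_of_genericMatrix_ne_zero {k : Fin m} {l : Fin (m + 1)}
    (h : genericMatrix K e k l ≠ 0) :
    ∃ d : Γ.Dart, d.edge = (e.dart k).edge ∧ d.fst = l ∧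
      Associated (genericMatrix K e k l) (MvPolynomial.X d) := by
  by_cases h₁ : l = (e.dart k).fst
  · subst h₁
    refine ⟨e.dart k, rfl, rfl, ?_⟩
    rw [genericMatrix_apply_fst]
    exact (Associated.refl _).neg_left
  · by_cases h₂ : l = (e.dart k).snd
    · subst h₂
      exact ⟨(e.dart k).symm, (e.dart k).edge_symm, rfl, by rw [genericMatrix_apply_snd]⟩
    · exact absurd (genericMatrix_apply_of_ne e k h₁ h₂) h

lemma genericMatrix_hasDistinctPrimeEntries : (genericMatrix K e).HasDistinctPrimeEntries where
  prime k l h := by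
    obtain ⟨d, -, -, hd⟩ := exists_associated_X_of_genericMatrix_ne_zero e h
    exact hd.symm.prime MvPolynomial.X_prime
  eq_of_dvd k l k' l' h h' hdvd := by
    obtain ⟨d, hdk, rfl, hd⟩ := exists_associated_X_of_genericMatrix_ne_zero e h
    obtain ⟨d', hdk', rfl, hd'⟩ := exists_associated_X_of_genericMatrix_ne_zero e h'
    rw [hd.dvd_iff_dvd_left, hd'.dvd_iff_dvd_right, MvPolynomial.X_dvd_X] at hdvd
    subst hdvd
    exact ⟨e.bijective.injective (Subtype.ext (hdk.symm.trans hdk')), rfl⟩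

lemma genericMatrix_isTreeLike (hΓ : Γ.Connected) : (genericMatrix K e).IsTreeLike where
  card_row_le k := by
    refine (Set.ncard_le_ncard (t := {(e.dart k).fst, (e.dart k).snd}) ?_
      (Set.toFinite _)).trans ((Set.ncard_insert_le _ _).trans (by simp))
    intro l hl
    by_contra hcon
    rw [Set.mem_insert_iff, Set.mem_singleton_iff, not_or] at hcon
    exact hl (genericMatrix_apply_of_ne e k hcon.1 hcon.2)
  connected C hC h := by
    obtain ⟨v, hv⟩ := hC
    have hfst (k : Fin m) : genericMatrix K e k (e.dart k).fst ≠ 0 := by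
      rw [genericMatrix_apply_fst, neg_ne_zero]
      exact MvPolynomial.X_ne_zero _
    have hsnd (k : Fin m) : genericMatrix K e k (e.dart k).snd ≠ 0 := by
      rw [genericMatrix_apply_snd]
      exact MvPolynomial.X_ne_zero _
    have hadj {i j : Fin (m + 1)} (hij : Γ.Adj i j) (hi : i ∈ C) : j ∈ C := by
      obtain ⟨k, hk⟩ := e.bijective.surjective ⟨s(i, j), hij⟩
      have hk' : (e.dart k).edge = s(i, j) := congrArg Subtype.val hk
      rcases SimpleGraph.dart_edge_eq_mk'_iff'.mp hk' with ⟨rfl, rfl⟩ | ⟨rfl, rfl⟩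
      · exact h k _ _ (hfst k) (hsnd k) hi
      · exact h k _ _ (hsnd k) (hfst k) hi
    refine Set.eq_univ_of_forall fun w => ?_
    obtain ⟨q⟩ := hΓ.preconnected v w
    induction q with
    | nil => exact hv
    | cons hij _ ih => exact ih (hadj hij hv)

/-- The two indeterminates of any edge generate an ideal containing `I(Γ)`. -/
lemma genericIdeal_le_span_pair (k : Fin m) :
    genericIdeal K e ≤ Ideal.span {MvPolynomial.X (e.dart k), MvPolynomial.X (e.dart k).symm} := by
  refine Ideal.span_le.mpr ?_
  rintro _ ⟨j, rfl⟩
  rw [SetLike.mem_coe, ← Ideal.Quotient.eq_zero_iff_mem, minor, RingHom.map_det]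
  refine Matrix.det_eq_zero_of_row_eq_zero k fun l => ?_
  rw [RingHom.mapMatrix_apply, Matrix.map_apply, Ideal.Quotient.eq_zero_iff_mem,
    Matrix.submatrix_apply, genericMatrix, Matrix.of_apply, id]
  split_ifs
  · exact neg_mem (Ideal.subset_span (by simp))
  · exact Ideal.subset_span (by simp)
  · exact zero_mem _

/-- Krull's height theorem, applied to the ideal of the two variables of an edge. -/
lemma height_genericIdeal_le_two (k : Fin m) : (genericIdeal K e).height ≤ 2 := by
  classical
  set s : Set (EdgeRing K Γ) := {MvPolynomial.X (e.dart k), MvPolynomial.X (e.dart k).symm}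
  have hne : Ideal.span s ≠ ⊤ := by
    intro htop
    have hle : Ideal.span s ≤ RingHom.ker (MvPolynomial.constantCoeff (σ := Γ.Dart) (R := K)) := by
      rw [Ideal.span_le]
      rintro _ (rfl | rfl) <;> simp [RingHom.mem_ker]
    rw [htop] at hle
    simpa [RingHom.mem_ker] using hle (Submodule.mem_top (x := 1))
  obtain ⟨P, hP⟩ := Ideal.nonempty_minimalPrimes hne
  have := hP.isPrime
  calc (genericIdeal K e).height ≤ P.height :=
        Ideal.height_mono ((genericIdeal_le_span_pair e k).trans hP.le)
    _ ≤ s.ncard := Ideal.height_le_card_of_mem_minimalPrimes_span (Set.toFinite s) hP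
    _ ≤ 2 := by exact_mod_cast (Set.ncard_insert_le _ _).trans (by simp)

lemma two_le_height_genericIdeal (hΓ : Γ.Connected) : 2 ≤ (genericIdeal K e).height := by
  rw [Ideal.height_eq_inf_minimalPrimes]
  refine le_iInf₂ fun P hP => ?_
  have := hP.isPrime
  exact (genericMatrix_isTreeLike e hΓ).two_le_height (genericMatrix_hasDistinctPrimeEntries e)
    hP.le

end GenericTreeIdeal

theorem corollary1p3 (K : Type*) [Field K] (m : ℕ) (hm : 1 ≤ m)
    (Γ : SimpleGraph (Fin (m + 1))) (hΓ : Γ.IsTree)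
    (e : GenericTreeIdeal.EdgeOrdering Γ) :
    GenericTreeIdeal.IsCohenMacaulayIdeal (GenericTreeIdeal.genericIdeal K e) ∧
      (GenericTreeIdeal.genericIdeal K e).height = 2 := by
  classical
  have hle := GenericTreeIdeal.height_genericIdeal_le_two (K := K) e ⟨0, hm⟩
  have hge := GenericTreeIdeal.two_le_height_genericIdeal (K := K) e hΓ.connected
  refine ⟨?_, le_antisymm hle hge⟩
  have hdim : ringKrullDim (GenericTreeIdeal.EdgeRing K Γ) = Nat.card Γ.Dart := by
    rw [MvPolynomial.ringKrullDim_of_isNoetherianRing, ringKrullDim_eq_zero_of_field, zero_add]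
  -- The proper ideal `I(Γ)` has height at least two, so `dim S`, the number of variables, is at
  -- least two.
  obtain ⟨d, hd⟩ : ∃ d, Nat.card Γ.Dart = d + 2 := by
    have hne : GenericTreeIdeal.genericIdeal K e ≠ ⊤ := by
      intro htop
      rw [htop, Ideal.height_top] at hle
      exact absurd hle (by simp)
    have h := (WithBot.coe_le_coe.mpr hge).trans (Ideal.height_le_ringKrullDim_of_ne_top hne)
    rw [hdim] at h
    exact Nat.exists_eq_add_of_le' (by exact_mod_cast h)
  have htree := GenericTreeIdeal.genericMatrix_isTreeLike (K := K) e hΓ.connected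
  have hentries := GenericTreeIdeal.genericMatrix_hasDistinctPrimeEntries (K := K) e
  refine GenericTreeIdeal.isCohenMacaulayIdeal_of_extVanishesBelow (d := d)
    (by rw [hdim, hd]) (fun P _ hP => htree.two_le_height hentries hP) fun n _ => ?_
  have hseq := MvPolynomial.hasRegularSequences K Γ.Dart
  rw [hd] at hseq
  exact htree.extVanishesBelow (hseq.extVanishesBelow n) hentries
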